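/- Let $\mathbf{Bicat}_2$ be the 2-category whose objects are the bicategories (whose objects, 1-cells and 2-cells form sets), whose 1-cells are the lax functors, and whose 2-cells are the icons. Here an icon $\alpha : F \to G$ between lax functors $F, G : \mathcal{A} \to \mathcal{B}$ exists only if $FA = GA$ for all objects $A$, and then consists of natural transformations $\alpha_{A,B} : F_{A,B} \to G_{A,B} : \mathcal{A}(A,B) \to \mathcal{B}(FA, FB)$, for all objects $A, B$, that are compatible with the composition constraints and the identity constraints of $F$ and $G$. A 1-cell $f : A \to B$ of a bicategory is called an equivalence if there is a 1-cell $g : B \to A$ with $gf \cong 1_A$ and $fg \cong 1_B$. A homomorphism (pseudofunctor) of bicategories is called a biequivalence if it is an equivalence on hom-categories and surjective on objects up to equivalence. A pseudonatural equivalence is a pseudonatural transformation whose components are equivalences. **Theorem.** Every bicategory is equivalent in $\mathbf{Bicat}_2$ to a strict bicategory (that is, a 2-category). Consequently $\mathbf{Bicat}_2$ is biequivalent to its full sub-2-category $\mathbf{S}$ consisting of the strict bicategories: the inclusion $J : \mathbf{S} \to \mathbf{Bicat}_2$ is a biequivalence, and there are a homomorphism $G : \mathbf{Bicat}_2 \to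 \mathbf{S}$ and pseudonatural equivalences $JG \to 1_{\mathbf{Bicat}_2}$ and $GJ \to 1_{\mathbf{S}}$. -/

import Mathlib

open CategoryTheory CategoryTheory.Bicategory

universe w v u w₁ v₁ u₁ w₂ v₂ u₂

namespace IconBicat

section HomCongr

variable {B : Type u} [Bicategory.{w, v} B]

/-- If `a = a'` and `b = b'` then the hom-categories `a' ⟶ b'` and `a ⟶ b` are the same category.
This is the identity functor between them, with domain and codomain written differently. -/
def homCongr {a a' b b' : B} (ha : a = a') (hb : b = b') : (a' ⟶ b') ⥤ (a ⟶ b) :=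
  match ha, hb with
  | rfl, rfl => 𝟭 _

theorem homCongr_rfl {a b : B} (ha : a = a) (hb : b = b) :
    homCongr ha hb = 𝟭 (a ⟶ b) := rfl

/-- The identification `homCongr` is compatible with composition of 1-cells. -/
theorem homCongr_obj_comp {a a' b b' c c' : B} (ha : a = a') (hb : b = b') (hc : c = c')
    (f : a' ⟶ b') (g : b' ⟶ c') :
    (homCongr ha hb).obj f ≫ (homCongr hb hc).obj g = (homCongr ha hc).obj (f ≫ g) := by
  subst ha hb hc
  rfl

/-- The identification `homCongr` is compatible with identity 1-cells. -/
theorem homCongr_obj_id {a a' : B} (ha : a = a') :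
    𝟙 a = (homCongr ha ha).obj (𝟙 a') := by
  subst ha
  rfl

theorem homCongr_obj_trans {a a' a'' b b' b'' : B} (ha : a = a') (hb : b = b')
    (ha' : a' = a'') (hb' : b' = b'') (f : a'' ⟶ b'') :
    (homCongr ha hb).obj ((homCongr ha' hb').obj f) =
      (homCongr (ha.trans ha') (hb.trans hb')).obj f := by
  subst ha hb ha' hb'
  rfl

theorem map_homCongr_obj {C : Type u₁} [Bicategory.{w₁, v₁} C] (H : B ⥤ᴸ C)
    {a a' b b' : B} (ha : a = a') (hb : b = b') (f : a' ⟶ b') :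
    H.map ((homCongr ha hb).obj f) =
      (homCongr (congrArg H.obj ha) (congrArg H.obj hb)).obj (H.map f) := by
  subst ha hb
  rfl

end HomCongr

section Aux

variable {C : Type u} [Bicategory.{w, v} C] {D : Type u₁} [Bicategory.{w₁, v₁} D]

theorem vcomp_naturality_aux {a a' a'' b b' b'' : C} (ha : a = a') (hb : b = b')
    (ha' : a' = a'') (hb' : b' = b'') {f₁ f₂ : a ⟶ b} {g₁ g₂ : a' ⟶ b'} {h₁ h₂ : a'' ⟶ b''}
    {φ : f₁ ⟶ f₂} {ψ : g₁ ⟶ g₂} {χ : h₁ ⟶ h₂}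
    {α₁ : f₁ ⟶ (homCongr ha hb).obj g₁} {α₂ : f₂ ⟶ (homCongr ha hb).obj g₂}
    {β₁ : g₁ ⟶ (homCongr ha' hb').obj h₁} {β₂ : g₂ ⟶ (homCongr ha' hb').obj h₂}
    (hα : φ ≫ α₂ = α₁ ≫ (homCongr ha hb).map ψ) (hβ : ψ ≫ β₂ = β₁ ≫ (homCongr ha' hb').map χ) :
    φ ≫ α₂ ≫ (homCongr ha hb).map β₂ ≫ eqToHom (homCongr_obj_trans _ _ _ _ _) =
      (α₁ ≫ (homCongr ha hb).map β₁ ≫ eqToHom (homCongr_obj_trans _ _ _ _ _)) ≫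
        (homCongr (ha.trans ha') (hb.trans hb')).map χ := by
  subst ha hb ha' hb'
  change f₁ ⟶ g₁ at α₁
  change f₂ ⟶ g₂ at α₂
  change g₁ ⟶ h₁ at β₁
  change g₂ ⟶ h₂ at β₂
  change φ ≫ α₂ = α₁ ≫ ψ at hα
  change ψ ≫ β₂ = β₁ ≫ χ at hβ
  change φ ≫ α₂ ≫ β₂ ≫ 𝟙 _ = (α₁ ≫ β₁ ≫ 𝟙 _) ≫ χ
  simp only [Category.comp_id, Category.assoc, reassoc_of% hα, hβ]

theorem vcomp_comp_aux {a a' a'' b b' b'' c c' c'' : C} (ha : a = a') (hb : b = b') (hc : c = c')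
    (ha' : a' = a'') (hb' : b' = b'') (hc' : c' = c'')
    {f₁ : a ⟶ b} {f₂ : b ⟶ c} {f₃ : a ⟶ c} {g₁ : a' ⟶ b'} {g₂ : b' ⟶ c'} {g₃ : a' ⟶ c'}
    {h₁ : a'' ⟶ b''} {h₂ : b'' ⟶ c''} {h₃ : a'' ⟶ c''}
    {φ : f₁ ≫ f₂ ⟶ f₃} {ψ : g₁ ≫ g₂ ⟶ g₃} {χ : h₁ ≫ h₂ ⟶ h₃}
    {α₁ : f₁ ⟶ (homCongr ha hb).obj g₁} {α₂ : f₂ ⟶ (homCongr hb hc).obj g₂}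
    {α₃ : f₃ ⟶ (homCongr ha hc).obj g₃}
    {β₁ : g₁ ⟶ (homCongr ha' hb').obj h₁} {β₂ : g₂ ⟶ (homCongr hb' hc').obj h₂}
    {β₃ : g₃ ⟶ (homCongr ha' hc').obj h₃}
    (hα : φ ≫ α₃ = (α₁ ▷ f₂ ≫ (homCongr ha hb).obj g₁ ◁ α₂) ≫
      eqToHom (homCongr_obj_comp ha hb hc g₁ g₂) ≫ (homCongr ha hc).map ψ)
    (hβ : ψ ≫ β₃ = (β₁ ▷ g₂ ≫ (homCongr ha' hb').obj h₁ ◁ β₂) ≫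
      eqToHom (homCongr_obj_comp ha' hb' hc' h₁ h₂) ≫ (homCongr ha' hc').map χ) :
    φ ≫ α₃ ≫ (homCongr ha hc).map β₃ ≫ eqToHom (homCongr_obj_trans _ _ _ _ _) =
      ((α₁ ≫ (homCongr ha hb).map β₁ ≫ eqToHom (homCongr_obj_trans _ _ _ _ _)) ▷ f₂ ≫
        (homCongr (ha.trans ha') (hb.trans hb')).obj h₁ ◁
          (α₂ ≫ (homCongr hb hc).map β₂ ≫ eqToHom (homCongr_obj_trans _ _ _ _ _))) ≫
      eqToHom (homCongr_obj_comp _ _ _ h₁ h₂) ≫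
        (homCongr (ha.trans ha') (hc.trans hc')).map χ := by
  subst ha hb hc ha' hb' hc'
  change f₁ ⟶ g₁ at α₁
  change f₂ ⟶ g₂ at α₂
  change f₃ ⟶ g₃ at α₃
  change g₁ ⟶ h₁ at β₁
  change g₂ ⟶ h₂ at β₂
  change g₃ ⟶ h₃ at β₃
  change φ ≫ α₃ = (α₁ ▷ f₂ ≫ g₁ ◁ α₂) ≫ 𝟙 _ ≫ ψ at hα
  change ψ ≫ β₃ = (β₁ ▷ g₂ ≫ h₁ ◁ β₂) ≫ 𝟙 _ ≫ χ at hβ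
  change φ ≫ α₃ ≫ β₃ ≫ 𝟙 _ =
    ((α₁ ≫ β₁ ≫ 𝟙 _) ▷ f₂ ≫ h₁ ◁ (α₂ ≫ β₂ ≫ 𝟙 _)) ≫ 𝟙 _ ≫ χ
  simp only [Category.id_comp, Category.assoc] at hα hβ
  simp only [Category.comp_id, Category.id_comp, Category.assoc, comp_whiskerRight,
    Bicategory.whiskerLeft_comp, reassoc_of% hα, hβ]
  rw [whisker_exchange_assoc]

theorem vcomp_id_aux {a a' a'' : C} (ha : a = a') (ha' : a' = a'')
    {f : a ⟶ a} {g : a' ⟶ a'} {h : a'' ⟶ a''}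
    {φ : 𝟙 a ⟶ f} {ψ : 𝟙 a' ⟶ g} {χ : 𝟙 a'' ⟶ h}
    {α : f ⟶ (homCongr ha ha).obj g} {β : g ⟶ (homCongr ha' ha').obj h}
    (hα : φ ≫ α = eqToHom (homCongr_obj_id ha) ≫ (homCongr ha ha).map ψ)
    (hβ : ψ ≫ β = eqToHom (homCongr_obj_id ha') ≫ (homCongr ha' ha').map χ) :
    φ ≫ α ≫ (homCongr ha ha).map β ≫ eqToHom (homCongr_obj_trans _ _ _ _ _) =
      eqToHom (homCongr_obj_id (ha.trans ha')) ≫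
        (homCongr (ha.trans ha') (ha.trans ha')).map χ := by
  subst ha ha'
  change f ⟶ g at α
  change g ⟶ h at β
  change φ ≫ α = 𝟙 _ ≫ ψ at hα
  change ψ ≫ β = 𝟙 _ ≫ χ at hβ
  change φ ≫ α ≫ β ≫ 𝟙 _ = 𝟙 _ ≫ χ
  simp only [Category.id_comp] at hα hβ
  simp only [Category.comp_id, Category.id_comp, reassoc_of% hα, hβ]

theorem whiskerLeft_comp_aux {a a' b b' c c' : C} (ha : a = a') (hb : b = b') (hc : c = c')
    {f₁ : a ⟶ b} {f₂ : b ⟶ c} {f₃ f₄ : a ⟶ c} {g₁ : a' ⟶ b'} {g₂ : b' ⟶ c'} {g₃ g₄ : a' ⟶ c'}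
    {φ : f₁ ≫ f₂ ⟶ f₃} {ψ : g₁ ≫ g₂ ⟶ g₃} {φ' : f₃ ⟶ f₄} {ψ' : g₃ ⟶ g₄}
    {α₁ : f₁ ⟶ (homCongr ha hb).obj g₁} {α₂ : f₂ ⟶ (homCongr hb hc).obj g₂}
    {α₃ : f₃ ⟶ (homCongr ha hc).obj g₃} {α₄ : f₄ ⟶ (homCongr ha hc).obj g₄}
    (hα : φ ≫ α₃ = (α₁ ▷ f₂ ≫ (homCongr ha hb).obj g₁ ◁ α₂) ≫
      eqToHom (homCongr_obj_comp ha hb hc g₁ g₂) ≫ (homCongr ha hc).map ψ)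
    (h : φ' ≫ α₄ = α₃ ≫ (homCongr ha hc).map ψ') :
    (φ ≫ φ') ≫ α₄ = (α₁ ▷ f₂ ≫ (homCongr ha hb).obj g₁ ◁ α₂) ≫
      eqToHom (homCongr_obj_comp ha hb hc g₁ g₂) ≫ (homCongr ha hc).map (ψ ≫ ψ') := by
  rw [Category.assoc, h, reassoc_of% hα, Functor.map_comp]
  simp only [Category.assoc]

theorem whiskerLeft_id_aux {a a' : C} (ha : a = a')
    {f₃ f₄ : a ⟶ a} {g₃ g₄ : a' ⟶ a'}
    {φ : 𝟙 a ⟶ f₃} {ψ : 𝟙 a' ⟶ g₃} {φ' : f₃ ⟶ f₄} {ψ' : g₃ ⟶ g₄}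
    {α₃ : f₃ ⟶ (homCongr ha ha).obj g₃} {α₄ : f₄ ⟶ (homCongr ha ha).obj g₄}
    (hα : φ ≫ α₃ = eqToHom (homCongr_obj_id ha) ≫ (homCongr ha ha).map ψ)
    (h : φ' ≫ α₄ = α₃ ≫ (homCongr ha ha).map ψ') :
    (φ ≫ φ') ≫ α₄ = eqToHom (homCongr_obj_id ha) ≫ (homCongr ha ha).map (ψ ≫ ψ') := by
  rw [Category.assoc, h, reassoc_of% hα, Functor.map_comp]

theorem whiskerRight_naturality_aux (H : C ⥤ᴸ D) {a a' b b' : C} (ha : a = a') (hb : b = b')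
    {f₁ f₂ : a ⟶ b} {g₁ g₂ : a' ⟶ b'} {φ : f₁ ⟶ f₂} {ψ : g₁ ⟶ g₂}
    {α₁ : f₁ ⟶ (homCongr ha hb).obj g₁} {α₂ : f₂ ⟶ (homCongr ha hb).obj g₂}
    (hα : φ ≫ α₂ = α₁ ≫ (homCongr ha hb).map ψ) :
    H.map₂ φ ≫ H.map₂ α₂ ≫ eqToHom (map_homCongr_obj H ha hb g₂) =
      (H.map₂ α₁ ≫ eqToHom (map_homCongr_obj H ha hb g₁)) ≫
        (homCongr (congrArg H.obj ha) (congrArg H.obj hb)).map (H.map₂ ψ) := by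
  subst ha hb
  change f₁ ⟶ g₁ at α₁
  change f₂ ⟶ g₂ at α₂
  change φ ≫ α₂ = α₁ ≫ ψ at hα
  change H.map₂ φ ≫ H.map₂ α₂ ≫ 𝟙 _ = (H.map₂ α₁ ≫ 𝟙 _) ≫ H.map₂ ψ
  rw [Category.comp_id, Category.comp_id, ← H.map₂_comp, hα, H.map₂_comp]

theorem whiskerRight_comp_aux (H : C ⥤ᴸ D) {a a' b b' c c' : C} (ha : a = a') (hb : b = b')
    (hc : c = c')
    {f₁ : a ⟶ b} {f₂ : b ⟶ c} {f₃ : a ⟶ c} {g₁ : a' ⟶ b'} {g₂ : b' ⟶ c'} {g₃ : a' ⟶ c'}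
    {φ : f₁ ≫ f₂ ⟶ f₃} {ψ : g₁ ≫ g₂ ⟶ g₃}
    {α₁ : f₁ ⟶ (homCongr ha hb).obj g₁} {α₂ : f₂ ⟶ (homCongr hb hc).obj g₂}
    {α₃ : f₃ ⟶ (homCongr ha hc).obj g₃}
    (hα : φ ≫ α₃ = (α₁ ▷ f₂ ≫ (homCongr ha hb).obj g₁ ◁ α₂) ≫
      eqToHom (homCongr_obj_comp ha hb hc g₁ g₂) ≫ (homCongr ha hc).map ψ) :
    (H.mapComp f₁ f₂ ≫ H.map₂ φ) ≫ H.map₂ α₃ ≫ eqToHom (map_homCongr_obj H ha hc g₃) =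
      ((H.map₂ α₁ ≫ eqToHom (map_homCongr_obj H ha hb g₁)) ▷ H.map f₂ ≫
        (homCongr (congrArg H.obj ha) (congrArg H.obj hb)).obj (H.map g₁) ◁
          (H.map₂ α₂ ≫ eqToHom (map_homCongr_obj H hb hc g₂))) ≫
      eqToHom (homCongr_obj_comp _ _ _ _ _) ≫
        (homCongr (congrArg H.obj ha) (congrArg H.obj hc)).map (H.mapComp g₁ g₂ ≫ H.map₂ ψ) := by
  subst ha hb hc
  change f₁ ⟶ g₁ at α₁
  change f₂ ⟶ g₂ at α₂
  change f₃ ⟶ g₃ at α₃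
  change φ ≫ α₃ = (α₁ ▷ f₂ ≫ g₁ ◁ α₂) ≫ 𝟙 _ ≫ ψ at hα
  change (H.mapComp f₁ f₂ ≫ H.map₂ φ) ≫ H.map₂ α₃ ≫ 𝟙 _ =
    ((H.map₂ α₁ ≫ 𝟙 _) ▷ H.map f₂ ≫ H.map g₁ ◁ (H.map₂ α₂ ≫ 𝟙 _)) ≫ 𝟙 _ ≫
      (H.mapComp g₁ g₂ ≫ H.map₂ ψ)
  simp only [Category.comp_id, Category.id_comp, Category.assoc] at hα ⊢
  rw [← H.map₂_comp, hα]
  simp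

theorem whiskerRight_id_aux (H : C ⥤ᴸ D) {a a' : C} (ha : a = a')
    {f : a ⟶ a} {g : a' ⟶ a'} {φ : 𝟙 a ⟶ f} {ψ : 𝟙 a' ⟶ g}
    {α : f ⟶ (homCongr ha ha).obj g}
    (hα : φ ≫ α = eqToHom (homCongr_obj_id ha) ≫ (homCongr ha ha).map ψ) :
    (H.mapId a ≫ H.map₂ φ) ≫ H.map₂ α ≫ eqToHom (map_homCongr_obj H ha ha g) =
      eqToHom (homCongr_obj_id (congrArg H.obj ha)) ≫
        (homCongr (congrArg H.obj ha) (congrArg H.obj ha)).map (H.mapId a' ≫ H.map₂ ψ) := by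
  subst ha
  change f ⟶ g at α
  change φ ≫ α = 𝟙 _ ≫ ψ at hα
  change (H.mapId a ≫ H.map₂ φ) ≫ H.map₂ α ≫ 𝟙 _ = 𝟙 _ ≫ (H.mapId a ≫ H.map₂ ψ)
  simp only [Category.comp_id, Category.id_comp, Category.assoc] at hα ⊢
  rw [← H.map₂_comp, hα]

end Aux

section Icon

variable {B : Type u} [Bicategory.{w, v} B] {C : Type u₁} [Bicategory.{w₁, v₁} C]
  {D : Type u₂} [Bicategory.{w₂, v₂} D]

/-- An icon `F ⟶ G` between lax functors. It exists only when `F` and `G` agree on objects, and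
then consists of a natural transformation between the actions
`(a ⟶ b) ⥤ (F.obj a ⟶ F.obj b) = (G.obj a ⟶ G.obj b)` on each hom-category, compatible with the
composition constraints and the identity constraints. -/
structure Icon (F G : B ⥤ᴸ C) where
  obj_eq : ∀ a : B, F.obj a = G.obj a
  app : ∀ {a b : B} (f : a ⟶ b), F.map f ⟶ (homCongr (obj_eq a) (obj_eq b)).obj (G.map f)
  naturality : ∀ {a b : B} {f g : a ⟶ b} (η : f ⟶ g),
    F.map₂ η ≫ app g = app f ≫ (homCongr (obj_eq a) (obj_eq b)).map (G.map₂ η)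
  app_comp : ∀ {a b c : B} (f : a ⟶ b) (g : b ⟶ c),
    F.mapComp f g ≫ app (f ≫ g) =
      (app f ▷ F.map g ≫ (homCongr (obj_eq a) (obj_eq b)).obj (G.map f) ◁ app g) ≫
        eqToHom (homCongr_obj_comp (obj_eq a) (obj_eq b) (obj_eq c) (G.map f) (G.map g)) ≫
          (homCongr (obj_eq a) (obj_eq c)).map (G.mapComp f g)
  app_id : ∀ a : B,
    F.mapId a ≫ app (𝟙 a) =
      eqToHom (homCongr_obj_id (obj_eq a)) ≫ (homCongr (obj_eq a) (obj_eq a)).map (G.mapId a)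

namespace Icon

theorem ext' {F G : B ⥤ᴸ C} {α β : Icon F G}
    (h : ∀ {a b : B} (f : a ⟶ b), α.app f = β.app f) : α = β := by
  cases α
  cases β
  congr
  funext a b f
  exact h f

/-- The identity icon. -/
def id (F : B ⥤ᴸ C) : Icon F F where
  obj_eq _ := rfl
  app f := 𝟙 (F.map f)
  naturality η := by simp [homCongr_rfl]
  app_comp f g := by simp [homCongr_rfl]
  app_id a := (Category.comp_id _).trans (Category.id_comp _).symm

/-- Vertical composition of icons, by composing the natural transformations. -/
def vcomp {F G H : B ⥤ᴸ C} (α : Icon F G) (β : Icon G H) : Icon F H where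
  obj_eq a := (α.obj_eq a).trans (β.obj_eq a)
  app {a b} f := α.app f ≫ (homCongr (α.obj_eq a) (α.obj_eq b)).map (β.app f) ≫
    eqToHom (homCongr_obj_trans _ _ _ _ _)
  naturality η := vcomp_naturality_aux _ _ _ _ (α.naturality η) (β.naturality η)
  app_comp f g := vcomp_comp_aux _ _ _ _ _ _ (α.app_comp f g) (β.app_comp f g)
  app_id a := vcomp_id_aux _ _ (α.app_id a) (β.app_id a)

/-- Precomposition of an icon with a lax functor. -/
def whiskerLeft (K : B ⥤ᴸ C) {F G : C ⥤ᴸ D} (α : Icon F G) : Icon (K.comp F) (K.comp G) where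
  obj_eq a := α.obj_eq (K.obj a)
  app f := α.app (K.map f)
  naturality η := α.naturality (K.map₂ η)
  app_comp f g := whiskerLeft_comp_aux _ _ _ (α.app_comp (K.map f) (K.map g))
    (α.naturality (K.mapComp f g))
  app_id a := whiskerLeft_id_aux _ (α.app_id (K.obj a)) (α.naturality (K.mapId a))

/-- Postcomposition of an icon with a lax functor. -/
def whiskerRight {F G : B ⥤ᴸ C} (α : Icon F G) (H : C ⥤ᴸ D) : Icon (F.comp H) (G.comp H) where
  obj_eq a := congrArg H.obj (α.obj_eq a)
  app {a b} f := H.map₂ (α.app f) ≫ eqToHom (map_homCongr_obj H (α.obj_eq a) (α.obj_eq b) (G.map f))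
  naturality η := whiskerRight_naturality_aux H _ _ (α.naturality η)
  app_comp f g := whiskerRight_comp_aux H _ _ _ (α.app_comp f g)
  app_id a := whiskerRight_id_aux H _ (α.app_id a)

end Icon

end Icon

section Laws

variable {C : Type u} [Bicategory.{w, v} C] {D : Type u₁} [Bicategory.{w₁, v₁} D]

theorem icon_comp_id_aux {a a' b b' : C} (ha : a = a') (hb : b = b') {f : a ⟶ b} {g : a' ⟶ b'}
    (α : f ⟶ (homCongr ha hb).obj g) :
    α ≫ (homCongr ha hb).map (𝟙 g) ≫
      eqToHom (homCongr_obj_trans ha hb rfl rfl g) = α := by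
  subst ha hb
  change f ⟶ g at α
  change α ≫ 𝟙 _ ≫ 𝟙 _ = α
  simp

theorem icon_assoc_aux {a a' a'' a₃ b b' b'' b₃ : C} (ha : a = a') (hb : b = b')
    (ha' : a' = a'') (hb' : b' = b'') (ha'' : a'' = a₃) (hb'' : b'' = b₃)
    {f : a ⟶ b} {g : a' ⟶ b'} {h : a'' ⟶ b''} {k : a₃ ⟶ b₃}
    (α : f ⟶ (homCongr ha hb).obj g) (β : g ⟶ (homCongr ha' hb').obj h)
    (γ : h ⟶ (homCongr ha'' hb'').obj k) :
    (α ≫ (homCongr ha hb).map β ≫ eqToHom (homCongr_obj_trans ha hb ha' hb' h)) ≫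
        (homCongr (ha.trans ha') (hb.trans hb')).map γ ≫
          eqToHom (homCongr_obj_trans (ha.trans ha') (hb.trans hb') ha'' hb'' k) =
      α ≫ (homCongr ha hb).map
          (β ≫ (homCongr ha' hb').map γ ≫ eqToHom (homCongr_obj_trans ha' hb' ha'' hb'' k)) ≫
        eqToHom (homCongr_obj_trans ha hb (ha'.trans ha'') (hb'.trans hb'') k) := by
  subst ha hb ha' hb' ha'' hb''
  change f ⟶ g at α
  change g ⟶ h at β
  change h ⟶ k at γ
  change (α ≫ β ≫ 𝟙 _) ≫ γ ≫ 𝟙 _ = α ≫ (β ≫ γ ≫ 𝟙 _) ≫ 𝟙 _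
  simp

theorem map₂_vcomp_aux (H : C ⥤ᴸ D) {a a' a'' b b' b'' : C} (ha : a = a') (hb : b = b')
    (ha' : a' = a'') (hb' : b' = b'') {f : a ⟶ b} {g : a' ⟶ b'} {h : a'' ⟶ b''}
    (α : f ⟶ (homCongr ha hb).obj g) (β : g ⟶ (homCongr ha' hb').obj h) :
    H.map₂ (α ≫ (homCongr ha hb).map β ≫ eqToHom (homCongr_obj_trans ha hb ha' hb' h)) ≫
        eqToHom (map_homCongr_obj H (ha.trans ha') (hb.trans hb') h) =
      (H.map₂ α ≫ eqToHom (map_homCongr_obj H ha hb g)) ≫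
        (homCongr (congrArg H.obj ha) (congrArg H.obj hb)).map
          (H.map₂ β ≫ eqToHom (map_homCongr_obj H ha' hb' h)) ≫
        eqToHom (homCongr_obj_trans _ _ _ _ _) := by
  subst ha hb ha' hb'
  change f ⟶ g at α
  change g ⟶ h at β
  change H.map₂ (α ≫ β ≫ 𝟙 _) ≫ 𝟙 _ = (H.map₂ α ≫ 𝟙 _) ≫ (H.map₂ β ≫ 𝟙 _) ≫ 𝟙 _
  simp

theorem map₂_comp_aux {E : Type u₂} [Bicategory.{w₂, v₂} E] (H : C ⥤ᴸ D) (K : D ⥤ᴸ E)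
    {a a' b b' : C} (ha : a = a') (hb : b = b') {f : a ⟶ b} {g : a' ⟶ b'}
    (α : f ⟶ (homCongr ha hb).obj g) :
    (H.comp K).map₂ α ≫ eqToHom (map_homCongr_obj (H.comp K) ha hb g) =
      K.map₂ (H.map₂ α ≫ eqToHom (map_homCongr_obj H ha hb g)) ≫
        eqToHom (map_homCongr_obj K (congrArg H.obj ha) (congrArg H.obj hb) (H.map g)) := by
  subst ha hb
  change f ⟶ g at α
  change K.map₂ (H.map₂ α) ≫ 𝟙 _ = K.map₂ (H.map₂ α ≫ 𝟙 _) ≫ 𝟙 _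
  rw [Category.comp_id (H.map₂ α)]

theorem exchange_aux {H K : C ⥤ᴸ D} (η : Icon H K)
    {a a' b b' : C} (ha : a = a') (hb : b = b') {f : a ⟶ b} {g : a' ⟶ b'}
    (α : f ⟶ (homCongr ha hb).obj g) :
    η.app f ≫ (homCongr (η.obj_eq a) (η.obj_eq b)).map
        (K.map₂ α ≫ eqToHom (map_homCongr_obj K ha hb g)) ≫
        eqToHom (homCongr_obj_trans _ _ _ _ _) =
      (H.map₂ α ≫ eqToHom (map_homCongr_obj H ha hb g)) ≫
        (homCongr (congrArg H.obj ha) (congrArg H.obj hb)).map (η.app g) ≫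
        eqToHom (homCongr_obj_trans _ _ (η.obj_eq a') (η.obj_eq b') _) := by
  subst ha hb
  change f ⟶ g at α
  change η.app f ≫ (homCongr (η.obj_eq a) (η.obj_eq b)).map (K.map₂ α ≫ 𝟙 _) ≫ 𝟙 _ =
    (H.map₂ α ≫ 𝟙 _) ≫ η.app g ≫ 𝟙 _
  simp only [Category.comp_id]
  exact (η.naturality α).symm

end Laws

/-- A bicategory (not necessarily strict), bundled, with objects in `Type u`, hom-categories with objects
in `Type v` and 2-cells in `Type w`. -/
structure BicatTwo : Type (max (u + 1) (v + 1) (w + 1)) where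
  carrier : Type u
  [str : Bicategory.{w, v} carrier]

namespace BicatTwo

attribute [instance] BicatTwo.str

instance : CategoryStruct BicatTwo.{w, v, u} where
  Hom A B := A.carrier ⥤ᴸ B.carrier
  id A := LaxFunctor.id A.carrier
  comp F G := F.comp G

/-- The category of lax functors and icons between two bicategories. -/
instance homCategory (A B : BicatTwo.{w, v, u}) : Category (A ⟶ B) where
  Hom F G := Icon F G
  id F := Icon.id F
  comp α β := α.vcomp β
  id_comp {F G} α := by
    apply Icon.ext'
    intro a b f
    change 𝟙 _ ≫ α.app f ≫ 𝟙 _ = α.app f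
    simp
  comp_id α := Icon.ext' fun f => icon_comp_id_aux _ _ (α.app f)
  assoc α β γ := Icon.ext' fun f => icon_assoc_aux _ _ _ _ _ _ (α.app f) (β.app f) (γ.app f)

theorem hom_ext {A B : BicatTwo.{w, v, u}} {F G : A ⟶ B} {α β : F ⟶ G}
    (h : ∀ {a b : A.carrier} (f : a ⟶ b), Icon.app α f = Icon.app β f) : α = β :=
  Icon.ext' h

theorem laxFunctor_ext {B : Type u} [Bicategory.{w, v} B] {C : Type u₁} [Bicategory.{w₁, v₁} C]
    {F G : B ⥤ᴸ C} (h : F.toPrelaxFunctor = G.toPrelaxFunctor)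
    (h₀ : F.mapId ≍ G.mapId) (h₁ : @LaxFunctor.mapComp _ _ _ _ F ≍ @LaxFunctor.mapComp _ _ _ _ G) :
    F = G := by
  cases F
  cases G
  cases h
  cases h₀
  cases h₁
  rfl

/-- Composition of lax functors is strictly associative. -/
theorem comp_assoc {A B C D : BicatTwo.{w, v, u}} (F : A ⟶ B) (G : B ⟶ C) (H : C ⟶ D) :
    (F ≫ G) ≫ H = F ≫ G ≫ H := by
  refine laxFunctor_ext rfl (heq_of_eq ?_) (heq_of_eq ?_)
  · funext a
    change LaxFunctor.mapId H _ ≫ H.map₂ (LaxFunctor.mapId G _ ≫ G.map₂ (LaxFunctor.mapId F a)) =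
      (LaxFunctor.mapId H _ ≫ H.map₂ (LaxFunctor.mapId G _)) ≫
        H.map₂ (G.map₂ (LaxFunctor.mapId F a))
    rw [PrelaxFunctor.map₂_comp, Category.assoc]
  · funext a b c f g
    change LaxFunctor.mapComp H _ _ ≫
        H.map₂ (LaxFunctor.mapComp G _ _ ≫ G.map₂ (LaxFunctor.mapComp F f g)) =
      (LaxFunctor.mapComp H _ _ ≫ H.map₂ (LaxFunctor.mapComp G _ _)) ≫
        H.map₂ (G.map₂ (LaxFunctor.mapComp F f g))
    rw [PrelaxFunctor.map₂_comp, Category.assoc]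

theorem id_comp {A B : BicatTwo.{w, v, u}} (F : A ⟶ B) : 𝟙 A ≫ F = F := by
  refine laxFunctor_ext rfl (heq_of_eq ?_) (heq_of_eq ?_)
  · funext a
    change LaxFunctor.mapId F a ≫ F.map₂ (𝟙 _) = LaxFunctor.mapId F a
    rw [PrelaxFunctor.map₂_id, Category.comp_id]
  · funext a b c f g
    change LaxFunctor.mapComp F f g ≫ F.map₂ (𝟙 _) = LaxFunctor.mapComp F f g
    rw [PrelaxFunctor.map₂_id, Category.comp_id]

theorem comp_id {A B : BicatTwo.{w, v, u}} (F : A ⟶ B) : F ≫ 𝟙 B = F := by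
  refine laxFunctor_ext rfl (heq_of_eq ?_) (heq_of_eq ?_)
  · funext a
    exact Category.id_comp _
  · funext a b c f g
    exact Category.id_comp _

theorem eqToHom_app {A B : BicatTwo.{w, v, u}} {F G : A ⟶ B} (h : F = G) {a b : A.carrier}
    (f : a ⟶ b) : Icon.app (eqToHom h) f = eqToHom (by subst h; rfl) := by
  subst h
  rfl

theorem conj_app {A B : BicatTwo.{w, v, u}} {F F' G G' : A ⟶ B} (h : F = F') (α : F' ⟶ G')
    (k : G' = G) {a b : A.carrier} (f : a ⟶ b) :
    Icon.app (eqToHom h ≫ α ≫ eqToHom k) f ≍ Icon.app α f := by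
  subst h k
  rw [eqToHom_refl, eqToHom_refl, Category.id_comp, Category.comp_id]

theorem id_whiskerRight {A B C : BicatTwo.{w, v, u}} (F : A ⟶ B) (H : B ⟶ C) :
    Icon.whiskerRight (𝟙 F : F ⟶ F) H = 𝟙 (F ≫ H) := by
  apply hom_ext
  intro a b f
  change H.map₂ (𝟙 _) ≫ 𝟙 _ = 𝟙 (H.map (F.map f))
  rw [PrelaxFunctor.map₂_id, Category.comp_id]

theorem eqToHom_whiskerRight {A B C : BicatTwo.{w, v, u}} {F G : A ⟶ B} (h : F = G) (H : B ⟶ C) :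
    Icon.whiskerRight (eqToHom h) H = eqToHom (congrArg (· ≫ H) h) := by
  subst h
  exact id_whiskerRight F H

theorem whiskerLeft_eqToHom {A B C : BicatTwo.{w, v, u}} (K : A ⟶ B) {F G : B ⟶ C} (h : F = G) :
    Icon.whiskerLeft K (eqToHom h) = eqToHom (congrArg (K ≫ ·) h) := by
  subst h
  rfl

/-- The 2-category of bicategories, lax functors and icons. -/
instance bicategory : Bicategory BicatTwo.{w, v, u} where
  homCategory := homCategory
  whiskerLeft K _ _ α := Icon.whiskerLeft K α
  whiskerRight α H := Icon.whiskerRight α H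
  associator F G H := eqToIso (comp_assoc F G H)
  leftUnitor F := eqToIso (id_comp F)
  rightUnitor F := eqToIso (comp_id F)
  whiskerLeft_id := by
    intros
    rfl
  whiskerLeft_comp := by
    intros
    rfl
  id_whiskerLeft {A B F G} α := hom_ext fun f => by
    refine eq_of_heq (HEq.trans (heq_of_eq ?_) (conj_app (id_comp _) α (id_comp _).symm f).symm)
    rfl
  comp_whiskerLeft K L F G α := hom_ext fun f => by
    refine eq_of_heq (HEq.trans (heq_of_eq ?_) (conj_app (comp_assoc K L F)
      (Icon.whiskerLeft K (Icon.whiskerLeft L α)) (comp_assoc K L G).symm f).symm)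
    rfl
  id_whiskerRight := id_whiskerRight
  comp_whiskerRight {A B C F G H} α β K := hom_ext fun f =>
    map₂_vcomp_aux K _ _ _ _ (Icon.app α f) (Icon.app β f)
  whiskerRight_id α := hom_ext fun f => by
    refine eq_of_heq (HEq.trans (heq_of_eq ?_) (conj_app (comp_id _) α (comp_id _).symm f).symm)
    exact Category.comp_id _
  whiskerRight_comp α H K := hom_ext fun f => by
    refine eq_of_heq (HEq.trans (heq_of_eq ?_) (conj_app (comp_assoc _ H K).symm
      (Icon.whiskerRight (Icon.whiskerRight α H) K) (comp_assoc _ H K) f).symm)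
    exact map₂_comp_aux H K _ _ (Icon.app α f)
  whisker_assoc K F G α H := hom_ext fun f => by
    refine eq_of_heq (HEq.trans (heq_of_eq ?_) (conj_app (comp_assoc K F H)
      (Icon.whiskerLeft K (Icon.whiskerRight α H)) (comp_assoc K G H).symm f).symm)
    rfl
  whisker_exchange η θ := hom_ext fun f => exchange_aux θ _ _ (Icon.app η f)
  pentagon F G H K := by
    simp only [eqToIso.hom]
    rw [eqToHom_whiskerRight, whiskerLeft_eqToHom]
    simp only [eqToHom_trans]
  triangle F G := by
    simp only [eqToIso.hom]
    rw [eqToHom_whiskerRight, whiskerLeft_eqToHom]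
    simp only [eqToHom_trans]

instance strict : Strict BicatTwo.{w, v, u} where
  id_comp := id_comp
  comp_id := comp_id
  assoc := comp_assoc
  leftUnitor_eqToIso _ := rfl
  rightUnitor_eqToIso _ := rfl
  associator_eqToIso _ _ _ := rfl

end BicatTwo

/-- The full sub-2-category of `BicatTwo` on the strict bicategories, that is, the 2-categories. -/
abbrev StrictBicatTwo : Type (max (u + 1) (v + 1) (w + 1)) :=
  InducedBicategory BicatTwo.{w, v, u}
    (fun A : {A : BicatTwo.{w, v, u} // Strict A.carrier} => A.1)

/-- The inclusion of the full sub-2-category of strict bicategories. -/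
def strictInclusion : StrictBicatTwo.{w, v, u} ⥤ᵖ BicatTwo.{w, v, u} :=
  (InducedBicategory.forget (C := BicatTwo.{w, v, u})
    (F := fun A : {A : BicatTwo.{w, v, u} // Strict A.carrier} => A.1)).toPseudofunctor

section Biequivalence

variable {B : Type u₁} [Bicategory.{w₁, v₁} B] {C : Type u₂} [Bicategory.{w₂, v₂} C]

/-- A 1-cell `f : a ⟶ b` of a bicategory is an equivalence if there is `g : b ⟶ a` such that both
composites are isomorphic to identities. -/
def IsEquivalenceCell {a b : B} (f : a ⟶ b) : Prop :=
  ∃ g : b ⟶ a, Nonempty (f ≫ g ≅ 𝟙 a) ∧ Nonempty (g ≫ f ≅ 𝟙 b)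

/-- A homomorphism of bicategories is a biequivalence if it is an equivalence on hom-categories
and surjective on objects up to equivalence. -/
structure IsBiequivalence (F : B ⥤ᵖ C) : Prop where
  hom_equivalence : ∀ a b : B, (F.mapFunctor a b).IsEquivalence
  surjective_up_to_equivalence : ∀ c : C, ∃ (b : B) (f : F.obj b ⟶ c), IsEquivalenceCell f

/-- A pseudonatural equivalence is a pseudonatural transformation whose components are
equivalences. -/
def IsPseudonaturalEquivalence {F G : B ⥤ᵖ C} (θ : Pseudofunctor.StrongTrans F G) : Prop :=
  ∀ b : B, IsEquivalenceCell (θ.app b)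

end Biequivalence

end IconBicat

/-! Strictness is gained by replacing 1-cells with formal composites. For a bicategory A, let the
strictification have the same objects, paths of 1-cells as 1-cells, and as 2-cells from p to q all
2-cells of A between their composites `eval p` and `eval q`. Concatenation of paths is strictly
associative and unital, so this is a 2-category once whiskering is transported along the canonical
isomorphisms `evalComp`; their compatibility with concatenation (`evalComp_assoc`,
`evalComp_nil_left`) is the coherence that makes the axioms hold.

Evaluation and the inclusion of 1-cells as paths of length one are lax functors in opposite
directions, both essentially the identity on objects. A path of length one on f evaluates to 𝟙 ≫ f,
so left unitors provide invertible icons from both composites to the identities. Hence A is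
equivalent to its strictification. Since a path runs through arbitrary intermediate objects, paths
live in the universe `max u v`; taking hom-categories there keeps the strictification at the same
universe levels.

The remaining claims are formal and hold in any bicategory C with a full sub-bicategory such that
every object a has a chosen equivalence e from an object of the sub-bicategory to a. The inclusion
is an isomorphism on hom-categories, hence a biequivalence. Conjugation by the chosen equivalences
is a homomorphism back, with constraints given by units and counits; the triangle identities yield
its unit laws. The equivalences e themselves, with naturality given by counits, are the components
of both required transformations. -/

namespace IconBicat

/-! ### Evaluation of paths and its coherence. -/

section PathEval

variable {A : Type u} [Bicategory.{w, v} A]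

open Quiver (Path)

/-- The composite of a path of 1-cells, bracketed to the left. -/
def eval {a : A} : ∀ {b : A}, Path a b → (a ⟶ b)
  | _, .nil => 𝟙 a
  | _, .cons p f => eval p ≫ f

/-- The canonical isomorphism between the composite of two composites and the composite of the
concatenated path. -/
def evalComp {a b : A} (p : Path a b) : ∀ {c : A} (q : Path b c),
    eval p ≫ eval q ≅ eval (p.comp q)
  | _, .nil => ρ_ (eval p)
  | _, .cons q f => (α_ (eval p) (eval q) f).symm ≪≫ whiskerRightIso (evalComp p q) f

/-- Lets an equality of paths pass through the last step of a longer path, as needed in the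
inductions below. -/
theorem eqToHom_comp_right {a b c : A} {f g : a ⟶ b} (h : f = g) (k : b ⟶ c) :
    eqToHom (congrArg (· ≫ k) h) = eqToHom h ▷ k := by
  subst h
  exact (id_whiskerRight _ _).symm

/-- Induction on the last path: adding a step f whiskers the previous instance by f, up to
associators. The `eqToHom` is needed because concatenation is associative only propositionally. -/
theorem evalComp_assoc {a b c : A} (p : Path a b) (q : Path b c) : ∀ {d : A} (r : Path c d),
    (evalComp p q).hom ▷ eval r ≫ (evalComp (p.comp q) r).hom ≫
        eqToHom (congrArg eval (Path.comp_assoc p q r)) =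
      (α_ (eval p) (eval q) (eval r)).hom ≫ eval p ◁ (evalComp q r).hom ≫
        (evalComp p (q.comp r)).hom
  | _, .nil => by
    change (evalComp p q).hom ▷ 𝟙 c ≫ (ρ_ _).hom ≫ 𝟙 _ =
      (α_ (eval p) (eval q) (𝟙 c)).hom ≫ eval p ◁ (ρ_ _).hom ≫ (evalComp p q).hom
    simp
  | _, .cons r f => by
    have h := congrArg (· ▷ f) (evalComp_assoc p q r)
    simp only [comp_whiskerRight] at h
    change (evalComp p q).hom ▷ (eval r ≫ f) ≫
      ((α_ _ _ f).inv ≫ (evalComp (p.comp q) r).hom ▷ f) ≫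
        eqToHom (congrArg (· ≫ f) (congrArg eval (Path.comp_assoc p q r))) =
      (α_ (eval p) (eval q) (eval r ≫ f)).hom ≫
        eval p ◁ ((α_ _ _ f).inv ≫ (evalComp q r).hom ▷ f) ≫
          ((α_ _ _ f).inv ≫ (evalComp p (q.comp r)).hom ▷ f)
    rw [eqToHom_comp_right (congrArg eval (Path.comp_assoc p q r))]
    simp only [Category.assoc, whiskerRight_comp, Iso.hom_inv_id_assoc, h,
      Bicategory.whiskerLeft_comp, whisker_assoc_symm]
    simp

theorem evalComp_nil_left {a : A} : ∀ {b : A} (p : Path a b),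
    (evalComp .nil p).hom ≫ eqToHom (congrArg eval (Path.nil_comp p)) = (λ_ (eval p)).hom
  | _, .nil => by
    change (ρ_ (𝟙 a)).hom ≫ 𝟙 _ = (λ_ (𝟙 a)).hom
    -- On the empty path `evalComp` is a right unitor, so the base case is the agreement of the two
    -- unitors at 𝟙.
    rw [Category.comp_id, unitors_equal]
  | _, .cons p f => by
    have h := congrArg (· ▷ f) (evalComp_nil_left p)
    simp only [comp_whiskerRight] at h
    change ((α_ _ _ f).inv ≫ (evalComp .nil p).hom ▷ f) ≫
      eqToHom (congrArg (· ≫ f) (congrArg eval (Path.nil_comp p))) =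
        (λ_ (eval p ≫ f)).hom
    rw [eqToHom_comp_right (congrArg eval (Path.nil_comp p)), Category.assoc, h, leftUnitor_comp]
    rfl

end PathEval

/-! ### The strict bicategory of paths. -/

/-- The strictification of a bicategory: 1-cells are paths of 1-cells, 2-cells are the 2-cells
between the composites of the paths. -/
structure Strictification (A : Type u) where
  of ::
  as : A

namespace Strictification

variable {A : Type u} [Bicategory.{w, v} A]

open Quiver (Path)

instance : CategoryStruct (Strictification A) where
  Hom a b := Path a.as b.as
  id _ := Path.nil
  comp p q := Path.comp p q

/-- The 1-cell of `A` underlying a 1-cell of the strictification. -/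
abbrev toHom {a b : Strictification A} (p : a ⟶ b) : a.as ⟶ b.as := eval p

instance homCategory (a b : Strictification A) : Category.{w} (a ⟶ b) where
  Hom p q := toHom p ⟶ toHom q
  id p := 𝟙 (toHom p)
  comp η θ := CategoryStruct.comp (obj := a.as ⟶ b.as) η θ
  id_comp _ := Category.id_comp (obj := a.as ⟶ b.as) _
  comp_id _ := Category.comp_id (obj := a.as ⟶ b.as) _
  assoc _ _ _ := Category.assoc (obj := a.as ⟶ b.as) _ _ _

/-- The 2-cell of `A` underlying a 2-cell of the strictification. -/
def toHom₂ {a b : Strictification A} {p q : a ⟶ b} (η : p ⟶ q) : toHom p ⟶ toHom q := η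

/-- A 2-cell between composites, as a 2-cell of the strictification. -/
def ofHom₂ {a b : Strictification A} {p q : a ⟶ b} (η : toHom p ⟶ toHom q) : p ⟶ q := η

/-- True by definition; it serves to move an equation into A, where simplification sees the
bicategory structure of A. -/
theorem hom₂_ext {a b : Strictification A} {p q : a ⟶ b} {η θ : p ⟶ q}
    (h : toHom₂ η = toHom₂ θ) : η = θ := h

@[simp] theorem toHom₂_id {a b : Strictification A} (p : a ⟶ b) :
    toHom₂ (𝟙 p) = 𝟙 (toHom p) := rfl

@[simp] theorem toHom₂_comp {a b : Strictification A} {p q r : a ⟶ b} (η : p ⟶ q) (θ : q ⟶ r) :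
    toHom₂ (η ≫ θ) = toHom₂ η ≫ toHom₂ θ := rfl

theorem toHom₂_eqToHom {a b : Strictification A} {p q : a ⟶ b} (h : p = q) :
    toHom₂ (eqToHom h) = eqToHom (congrArg toHom h) := by
  subst h
  rfl

/-- The comparison between composition in `A` and in the strictification. -/
def μ {a b c : Strictification A} (p : a ⟶ b) (q : b ⟶ c) :
    toHom p ≫ toHom q ≅ toHom (p ≫ q) := evalComp p q

protected theorem assoc {a b c d : Strictification A} (p : a ⟶ b) (q : b ⟶ c) (r : c ⟶ d) :
    (p ≫ q) ≫ r = p ≫ q ≫ r := Path.comp_assoc _ _ _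

protected theorem id_comp {a b : Strictification A} (p : a ⟶ b) : 𝟙 a ≫ p = p := Path.nil_comp _

protected theorem comp_id {a b : Strictification A} (p : a ⟶ b) : p ≫ 𝟙 b = p := rfl

theorem μ_assoc {a b c d : Strictification A} (p : a ⟶ b) (q : b ⟶ c) (r : c ⟶ d) :
    (μ p q).hom ▷ toHom r ≫ (μ (p ≫ q) r).hom ≫
        toHom₂ (eqToHom (Strictification.assoc p q r)) =
      (α_ (toHom p) (toHom q) (toHom r)).hom ≫ toHom p ◁ (μ q r).hom ≫ (μ p (q ≫ r)).hom := by
  rw [toHom₂_eqToHom]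
  exact evalComp_assoc p q r

theorem μ_assoc_assoc {a b c d : Strictification A} (p : a ⟶ b) (q : b ⟶ c) (r : c ⟶ d)
    {f : a.as ⟶ d.as} (η : toHom (p ≫ q ≫ r) ⟶ f) :
    (μ p q).hom ▷ toHom r ≫ (μ (p ≫ q) r).hom ≫
        toHom₂ (eqToHom (Strictification.assoc p q r)) ≫ η =
      (α_ (toHom p) (toHom q) (toHom r)).hom ≫ toHom p ◁ (μ q r).hom ≫
        (μ p (q ≫ r)).hom ≫ η := by
  simpa only [Category.assoc] using congrArg (· ≫ η) (μ_assoc p q r)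

theorem μ_id_left {a b : Strictification A} (p : a ⟶ b) :
    (μ (𝟙 a) p).hom ≫ toHom₂ (eqToHom (Strictification.id_comp p)) = (λ_ (toHom p)).hom := by
  rw [toHom₂_eqToHom]
  exact evalComp_nil_left p

/-- Left whiskering in the strictification. -/
def whiskerLeft {a b c : Strictification A} (p : a ⟶ b) {q r : b ⟶ c} (η : q ⟶ r) :
    p ≫ q ⟶ p ≫ r := ofHom₂ ((μ p q).inv ≫ toHom p ◁ toHom₂ η ≫ (μ p r).hom)

/-- Right whiskering in the strictification. -/
def whiskerRight {a b c : Strictification A} {p q : a ⟶ b} (η : p ⟶ q) (r : b ⟶ c) :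
    p ≫ r ⟶ q ≫ r := ofHom₂ ((μ p r).inv ≫ toHom₂ η ▷ toHom r ≫ (μ q r).hom)

theorem toHom₂_whiskerLeft {a b c : Strictification A} (p : a ⟶ b) {q r : b ⟶ c} (η : q ⟶ r) :
    toHom₂ (whiskerLeft p η) = (μ p q).inv ≫ toHom p ◁ toHom₂ η ≫ (μ p r).hom := rfl

theorem toHom₂_whiskerRight {a b c : Strictification A} {p q : a ⟶ b} (η : p ⟶ q) (r : b ⟶ c) :
    toHom₂ (whiskerRight η r) = (μ p r).inv ≫ toHom₂ η ▷ toHom r ≫ (μ q r).hom := rfl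

theorem whiskerLeft_eqToHom {a b c : Strictification A} (p : a ⟶ b) {q r : b ⟶ c} (h : q = r) :
    whiskerLeft p (eqToHom h) = eqToHom (congrArg (p ≫ ·) h) := by
  subst h
  apply hom₂_ext
  simp [toHom₂_whiskerLeft]

theorem whiskerRight_eqToHom {a b c : Strictification A} {p q : a ⟶ b} (h : p = q) (r : b ⟶ c) :
    whiskerRight (eqToHom h) r = eqToHom (congrArg (· ≫ r) h) := by
  subst h
  apply hom₂_ext
  simp [toHom₂_whiskerRight]

/-- The bicategory axioms conjugate by unitors or associators. Moving the inverse across leaves one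
`eqToHom` at the end of each side, the position in which `μ_assoc` and `μ_id_left` absorb it. -/
theorem eq_eqToIso_conj {C : Type*} [Category C] {x y z w : C} {f : x ⟶ y} {h : y = z} {k : x = w}
    {g : w ⟶ z} (e : f ≫ eqToHom h = eqToHom k ≫ g) :
    f = (eqToIso k).hom ≫ g ≫ (eqToIso h).inv := by
  subst h k
  simpa using e

theorem eq_eqToIso_conj' {C : Type*} [Category C] {x y z w : C} {f : x ⟶ y} {h : z = y}
    {k : w = x} {g : w ⟶ z} (e : eqToHom k ≫ f = g ≫ eqToHom h) :
    f = (eqToIso k).inv ≫ g ≫ (eqToIso h).hom := by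
  subst h k
  simpa using e

instance bicategory : Bicategory (Strictification A) where
  homCategory := homCategory
  whiskerLeft p _ _ η := whiskerLeft p η
  whiskerRight η r := whiskerRight η r
  associator p q r := eqToIso (Strictification.assoc p q r)
  leftUnitor p := eqToIso (Strictification.id_comp p)
  rightUnitor p := eqToIso (Strictification.comp_id p)
  whiskerLeft_id p q := whiskerLeft_eqToHom p rfl
  whiskerLeft_comp p _ _ _ η θ := hom₂_ext (by simp [toHom₂_whiskerLeft])
  id_whiskerLeft {a b p q} η := eq_eqToIso_conj <| hom₂_ext <| by
    simp only [toHom₂_comp, toHom₂_whiskerLeft, Category.assoc, μ_id_left]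
    rw [Iso.inv_comp_eq, reassoc_of% (μ_id_left p)]
    exact leftUnitor_naturality _
  comp_whiskerLeft p q r s η := eq_eqToIso_conj <| hom₂_ext <| by
    simp only [toHom₂_comp, toHom₂_whiskerLeft, Category.assoc]
    -- Precomposing with this invertible cell completes the left side of `μ_assoc`, which then
    -- replaces the `eqToHom` by an associator of A.
    rw [Iso.inv_comp_eq, ← cancel_epi ((μ p q).hom ▷ toHom r), μ_assoc_assoc,
      ← whisker_exchange_assoc, μ_assoc]
    simp
  id_whiskerRight p r := whiskerRight_eqToHom rfl r
  comp_whiskerRight η θ r := hom₂_ext (by simp [toHom₂_whiskerRight])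
  whiskerRight_id {a b p q} η := eq_eqToIso_conj <| hom₂_ext <| by
    -- Concatenation recurses on its second argument, so the right unit law is definitional and its
    -- `eqToHom` is an identity.
    change toHom₂ (whiskerRight η (𝟙 b) ≫ 𝟙 (q ≫ 𝟙 b)) = toHom₂ (𝟙 p ≫ η)
    rw [Category.comp_id, Category.id_comp]
    exact (Iso.inv_comp_eq _).2 (rightUnitor_naturality (toHom₂ η))
  whiskerRight_comp {a b c d p q} η r s := eq_eqToIso_conj' <| hom₂_ext <| by
    simp only [toHom₂_comp, toHom₂_whiskerRight, Category.assoc]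
    rw [← cancel_epi (μ (p ≫ r) s).hom, Iso.hom_inv_id_assoc, ← cancel_epi ((μ p r).hom ▷ toHom s),
      μ_assoc_assoc, Iso.hom_inv_id_assoc, whisker_exchange_assoc]
    simp [μ_assoc]
  whisker_assoc {a b c d} p q r η s := eq_eqToIso_conj <| hom₂_ext <| by
    simp only [toHom₂_comp, toHom₂_whiskerRight, toHom₂_whiskerLeft, Category.assoc]
    rw [Iso.inv_comp_eq, ← cancel_epi ((μ p q).hom ▷ toHom s), μ_assoc_assoc]
    simp [μ_assoc]
  whisker_exchange η θ := hom₂_ext (by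
    simp [toHom₂_whiskerLeft, toHom₂_whiskerRight, whisker_exchange_assoc])
  pentagon p q r s := by
    -- Both sides are composites of `eqToHom`s with the same ends.
    simp only [eqToIso.hom, whiskerLeft_eqToHom, whiskerRight_eqToHom, eqToHom_trans]
  triangle p q := by
    simp only [eqToIso.hom, whiskerLeft_eqToHom, whiskerRight_eqToHom, eqToHom_trans]

instance strict : Strict (Strictification A) where
  id_comp := Strictification.id_comp
  comp_id := Strictification.comp_id
  assoc := Strictification.assoc
  leftUnitor_eqToIso _ := rfl
  rightUnitor_eqToIso _ := rfl
  associator_eqToIso _ _ _ := Iso.ext rfl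

theorem toHom₂_leftUnitor_inv {a b : Strictification A} (p : a ⟶ b) :
    toHom₂ (λ_ p).inv = (λ_ (toHom p)).inv ≫ (μ (𝟙 a) p).hom := by
  have h : toHom₂ (eqToHom (Strictification.id_comp p)) ≫ toHom₂ (λ_ p).inv = 𝟙 _ :=
    congrArg toHom₂ (λ_ p).hom_inv_id
  refine (Iso.eq_inv_comp _).2
    ((congrArg (· ≫ toHom₂ (λ_ p).inv) (μ_id_left p)).symm.trans ?_)
  exact (Category.assoc _ _ _).trans
    ((congrArg ((μ (𝟙 a) p).hom ≫ ·) h).trans (Category.comp_id _))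

/-! ### The two comparison lax functors. -/

/-- Composition of paths, as a lax functor from the strictification. -/
def evalLax (A : Type u) [Bicategory.{w, v} A] : Strictification A ⥤ᴸ A where
  obj a := a.as
  map p := toHom p
  map₂ η := toHom₂ η
  mapId a := 𝟙 (toHom (𝟙 a))
  mapComp p q := (μ p q).hom
  mapComp_naturality_left η q := by
    change _ ≫ toHom₂ (whiskerRight η q) = _
    simp [toHom₂_whiskerRight]
  mapComp_naturality_right p _ _ η := by
    change _ ≫ toHom₂ (whiskerLeft p η) = _
    simp [toHom₂_whiskerLeft]
  map₂_associator p q r := μ_assoc p q r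
  map₂_leftUnitor {a b} p := by
    refine (toHom₂_leftUnitor_inv p).trans (congrArg ((λ_ (toHom p)).inv ≫ ·) ?_)
    exact ((congrArg (· ≫ (μ (𝟙 a) p).hom) (id_whiskerRight _ _)).trans (Category.id_comp _)).symm
  map₂_rightUnitor {a b} p := by
    change 𝟙 (toHom p) = (ρ_ (toHom p)).inv ≫ toHom p ◁ 𝟙 (𝟙 b.as) ≫ (ρ_ (toHom p)).hom
    simp

/-- A 1-cell as a path of length one. -/
def single {a b : A} (f : a ⟶ b) : of a ⟶ of b := Path.cons Path.nil f

/-- The 2-cell between paths of length one induced by a 2-cell. -/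
def single₂ {a b : A} {f g : a ⟶ b} (η : f ⟶ g) : single f ⟶ single g :=
  ofHom₂ (𝟙 a ◁ η : 𝟙 a ≫ f ⟶ 𝟙 a ≫ g)

/-- The comparison from the empty path to the path consisting of the identity. -/
def singleId (a : A) : 𝟙 (of a) ⟶ single (𝟙 a) := ofHom₂ (λ_ (𝟙 a)).inv

/-- The comparison from a path of length two to the path consisting of the composite. -/
def singleComp {a b c : A} (f : a ⟶ b) (g : b ⟶ c) : single f ≫ single g ⟶ single (f ≫ g) :=
  ofHom₂ (α_ (𝟙 a) f g).hom

/-- The inclusion of 1-cells as paths of length one, as a lax functor to the strictification. -/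
def singleLax (A : Type u) [Bicategory.{w, v} A] : A ⥤ᴸ Strictification A where
  obj a := of a
  map f := single f
  map₂ η := single₂ η
  map₂_id f := Bicategory.whiskerLeft_id _ _
  map₂_comp η θ := Bicategory.whiskerLeft_comp _ _ _
  mapId a := singleId a
  mapComp f g := singleComp f g
  mapComp_naturality_left {a b c f f'} η g := hom₂_ext <| by
    -- For a second path of length one, `μ` unfolds to an associator followed by a right unitor, so
    -- only structural cells and η remain and coherence in A suffices; the other axioms below go the
    -- same way.
    change (α_ (𝟙 a) f g).hom ≫ 𝟙 a ◁ η ▷ g =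
      (((ρ_ (𝟙 a ≫ f)).inv ▷ g ≫ (α_ _ _ _).hom) ≫ (𝟙 a ◁ η) ▷ (𝟙 b ≫ g) ≫
        (α_ _ _ _).inv ≫ (ρ_ (𝟙 a ≫ f')).hom ▷ g) ≫ (α_ (𝟙 a) f' g).hom
    bicategory
  mapComp_naturality_right {a b c} f {g g'} η := hom₂_ext <| by
    change (α_ (𝟙 a) f g).hom ≫ 𝟙 a ◁ f ◁ η =
      (((ρ_ (𝟙 a ≫ f)).inv ▷ g ≫ (α_ _ _ _).hom) ≫ (𝟙 a ≫ f) ◁ (𝟙 b ◁ η) ≫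
        (α_ _ _ _).inv ≫ (ρ_ (𝟙 a ≫ f)).hom ▷ g') ≫ (α_ (𝟙 a) f g').hom
    bicategory
  map₂_associator {a b c d} f g h := hom₂_ext <| by
    change (((ρ_ ((𝟙 a ≫ f) ≫ g)).inv ▷ h ≫ (α_ _ _ _).hom) ≫
        (α_ (𝟙 a) f g).hom ▷ (𝟙 c ≫ h) ≫ (α_ _ _ _).inv ≫ (ρ_ (𝟙 a ≫ f ≫ g)).hom ▷ h) ≫
        (α_ (𝟙 a) (f ≫ g) h).hom ≫ 𝟙 a ◁ (α_ f g h).hom =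
      𝟙 (((𝟙 a ≫ f) ≫ g) ≫ h) ≫ ((((ρ_ (𝟙 a ≫ f)).inv ▷ g ≫ (α_ _ _ _).hom) ▷ h ≫ (α_ _ _ _).hom) ≫
        (𝟙 a ≫ f) ◁ (α_ (𝟙 b) g h).hom ≫ (α_ _ _ _).inv ≫ (ρ_ (𝟙 a ≫ f)).hom ▷ (g ≫ h)) ≫
        (α_ (𝟙 a) f (g ≫ h)).hom
    bicategory
  map₂_leftUnitor {a b} f := hom₂_ext <| by
    change 𝟙 a ◁ (λ_ f).inv = 𝟙 (𝟙 a ≫ f) ≫ (((ρ_ (𝟙 a)).inv ▷ f ≫ (α_ _ _ _).hom) ≫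
      (λ_ (𝟙 a)).inv ▷ (𝟙 a ≫ f) ≫ (α_ _ _ _).inv ≫ (ρ_ (𝟙 a ≫ 𝟙 a)).hom ▷ f) ≫
        (α_ (𝟙 a) (𝟙 a) f).hom
    bicategory
  map₂_rightUnitor {a b} f := hom₂_ext <| by
    change 𝟙 a ◁ (ρ_ f).inv = 𝟙 (𝟙 a ≫ f) ≫ ((ρ_ (𝟙 a ≫ f)).inv ≫
      (𝟙 a ≫ f) ◁ (λ_ (𝟙 b)).inv ≫ (α_ _ _ _).inv ≫ (ρ_ (𝟙 a ≫ f)).hom ▷ 𝟙 b) ≫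
        (α_ (𝟙 a) f (𝟙 b)).hom
    bicategory

end Strictification

/-! ### Invertible icons and the equivalence with the strictification. -/

open Strictification

/-- The icon from the composite of the lax functors between a bicategory and its strictification
to the identity of the strictification. -/
def evalSingleIcon (A : Type u) [Bicategory.{w, v} A] :
    Icon ((evalLax A).comp (singleLax A)) (LaxFunctor.id (Strictification A)) where
  obj_eq _ := rfl
  app p := ofHom₂ (λ_ (toHom p)).hom
  naturality η := hom₂_ext (leftUnitor_naturality (toHom₂ η))
  app_comp {a b c} p q := hom₂_ext <| by
    change ((α_ (𝟙 a.as) (toHom p) (toHom q)).hom ≫ 𝟙 a.as ◁ (μ p q).hom) ≫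
        (λ_ (toHom (p ≫ q))).hom =
      ((((ρ_ (𝟙 a.as ≫ toHom p)).inv ▷ toHom q ≫ (α_ _ _ _).hom) ≫
        (λ_ (toHom p)).hom ▷ (𝟙 b.as ≫ toHom q) ≫
          (α_ _ _ _).inv ≫ (ρ_ (toHom p)).hom ▷ toHom q) ≫
        (((ρ_ (toHom p)).inv ▷ toHom q ≫ (α_ _ _ _).hom) ≫
          toHom p ◁ (λ_ (toHom q)).hom ≫ (μ p q).hom)) ≫
        𝟙 (toHom (p ≫ q)) ≫ 𝟙 (toHom (p ≫ q))
    bicategory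
  app_id a := hom₂_ext <| by
    change ((λ_ (𝟙 a.as)).inv ≫ 𝟙 a.as ◁ 𝟙 (𝟙 a.as)) ≫ (λ_ (𝟙 a.as)).hom = 𝟙 _ ≫ 𝟙 (𝟙 a.as)
    simp

/-- The inverse of `evalSingleIcon`. -/
def evalSingleIconInv (A : Type u) [Bicategory.{w, v} A] :
    Icon (LaxFunctor.id (Strictification A)) ((evalLax A).comp (singleLax A)) where
  obj_eq _ := rfl
  app p := ofHom₂ (λ_ (toHom p)).inv
  naturality η := hom₂_ext (leftUnitor_inv_naturality (toHom₂ η))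
  app_comp {a b c} p q := hom₂_ext <| by
    -- The comparison for a length-one path followed by the arbitrary path q does not unfold, but it
    -- occurs next to its inverse; it is therefore generalized to any isomorphism m.
    have h {x : a.as ⟶ c.as} (m : (𝟙 a.as ≫ toHom p) ≫ toHom q ≅ x) :
        𝟙 (toHom (p ≫ q)) ≫ (λ_ (toHom (p ≫ q))).inv =
          (((μ p q).inv ≫ (λ_ (toHom p)).inv ▷ toHom q ≫ m.hom) ≫
            (m.inv ≫ (𝟙 a.as ≫ toHom p) ◁ (λ_ (toHom q)).inv ≫
              (α_ _ _ _).inv ≫ (ρ_ (𝟙 a.as ≫ toHom p)).hom ▷ toHom q)) ≫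
            𝟙 ((𝟙 a.as ≫ toHom p) ≫ toHom q) ≫
              (α_ (𝟙 a.as) (toHom p) (toHom q)).hom ≫ 𝟙 a.as ◁ (μ p q).hom := by
      rw [← cancel_epi (μ p q).hom]
      simp
    exact h (μ (single (toHom p)) q)
  app_id a := hom₂_ext <| by
    change 𝟙 (𝟙 a.as) ≫ (λ_ (𝟙 a.as)).inv = 𝟙 _ ≫ (λ_ (𝟙 a.as)).inv ≫ 𝟙 a.as ◁ 𝟙 (𝟙 a.as)
    simp

/-- The icon from the composite of the lax functors between a bicategory and its strictification
to the identity of the bicategory. -/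
def singleEvalIcon (A : Type u) [Bicategory.{w, v} A] :
    Icon ((singleLax A).comp (evalLax A)) (LaxFunctor.id A) where
  obj_eq _ := rfl
  app f := (λ_ f).hom
  naturality η := leftUnitor_naturality η
  app_comp {a b c} f g := by
    change (((α_ _ _ _).inv ≫ (ρ_ (𝟙 a ≫ f)).hom ▷ g) ≫ (α_ (𝟙 a) f g).hom) ≫ (λ_ (f ≫ g)).hom =
      ((λ_ f).hom ▷ (𝟙 b ≫ g) ≫ f ◁ (λ_ g).hom) ≫ 𝟙 (f ≫ g) ≫ 𝟙 (f ≫ g)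
    bicategory
  app_id a := by
    change (𝟙 (𝟙 a) ≫ (λ_ (𝟙 a)).inv) ≫ (λ_ (𝟙 a)).hom = 𝟙 (𝟙 a) ≫ 𝟙 (𝟙 a)
    simp

/-- The inverse of `singleEvalIcon`. -/
def singleEvalIconInv (A : Type u) [Bicategory.{w, v} A] :
    Icon (LaxFunctor.id A) ((singleLax A).comp (evalLax A)) where
  obj_eq _ := rfl
  app f := (λ_ f).inv
  naturality η := leftUnitor_inv_naturality η
  app_comp {a b c} f g := by
    change 𝟙 (f ≫ g) ≫ (λ_ (f ≫ g)).inv =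
      ((λ_ f).inv ▷ g ≫ (𝟙 a ≫ f) ◁ (λ_ g).inv) ≫ 𝟙 ((𝟙 a ≫ f) ≫ 𝟙 b ≫ g) ≫
        ((α_ _ _ _).inv ≫ (ρ_ (𝟙 a ≫ f)).hom ▷ g) ≫ (α_ (𝟙 a) f g).hom
    bicategory
  app_id a := by
    change 𝟙 (𝟙 a) ≫ (λ_ (𝟙 a)).inv = 𝟙 (𝟙 a) ≫ 𝟙 (𝟙 a) ≫ (λ_ (𝟙 a)).inv
    simp

namespace BicatTwo

/-- The strictification of a bundled bicategory. -/
def strictify (A : BicatTwo.{w, max u v, u}) : BicatTwo.{w, max u v, u} :=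
  ⟨Strictification A.carrier⟩

theorem strictify_strict (A : BicatTwo.{w, max u v, u}) : Strict A.strictify.carrier :=
  Strictification.strict

/-- Every bicategory is equivalent to its strictification. -/
noncomputable def strictifyEquivalence (A : BicatTwo.{w, max u v, u}) : A.strictify ≌ A :=
  -- The counit is adjusted so that the triangle identities hold; conjugation relies on them later.
  Equivalence.mkOfAdjointifyCounit (f := (evalLax A.carrier : A.strictify ⟶ A))
    (g := (singleLax A.carrier : A ⟶ A.strictify))
    { hom := evalSingleIconInv A.carrier
      inv := evalSingleIcon A.carrier
      hom_inv_id := hom_ext fun {a b} p => hom₂_ext <| by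
        change (λ_ (toHom p)).inv ≫ (λ_ (toHom p)).hom ≫ 𝟙 (toHom p) = 𝟙 (toHom p)
        simp
      inv_hom_id := hom_ext fun {a b} p => hom₂_ext <| by
        change (λ_ (toHom p)).hom ≫ (λ_ (toHom p)).inv ≫ 𝟙 (𝟙 a.as ≫ toHom p) = 𝟙 _
        simp }
    { hom := singleEvalIcon A.carrier
      inv := singleEvalIconInv A.carrier
      hom_inv_id := hom_ext fun {a b} f => by
        change (λ_ f).hom ≫ (λ_ f).inv ≫ 𝟙 (𝟙 a ≫ f) = 𝟙 _
        simp
      inv_hom_id := hom_ext fun {a b} f => by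
        change (λ_ f).inv ≫ (λ_ f).hom ≫ 𝟙 f = 𝟙 f
        simp }

end BicatTwo

/-! ### Conjugation by adjoint equivalences. -/

section Conjugation

variable {C : Type u} [Bicategory.{w, v} C] {a b c d a' b' c' d' : C}

/-- Conjugation of a 1-cell by equivalences. -/
abbrev conj (e : a' ≌ a) (e' : b' ≌ b) (f : a ⟶ b) : a' ⟶ b' := e.hom ≫ f ≫ e'.inv

/-- Conjugation of a 2-cell by equivalences. -/
abbrev conj₂ (e : a' ≌ a) (e' : b' ≌ b) {f g : a ⟶ b} (η : f ⟶ g) : conj e e' f ⟶ conj e e' g :=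
  e.hom ◁ η ▷ e'.inv

theorem conj₂_id (e : a' ≌ a) (e' : b' ≌ b) (f : a ⟶ b) : conj₂ e e' (𝟙 f) = 𝟙 (conj e e' f) := by
  simp [conj₂]

theorem conj₂_comp (e : a' ≌ a) (e' : b' ≌ b) {f g h : a ⟶ b} (η : f ⟶ g) (θ : g ⟶ h) :
    conj₂ e e' (η ≫ θ) = conj₂ e e' η ≫ conj₂ e e' θ := by
  simp [conj₂]

/-- Conjugation preserves identities, by the unit. -/
def conjId (e : a' ≌ a) : conj e e (𝟙 a) ≅ 𝟙 a' :=
  whiskerLeftIso e.hom (λ_ e.inv) ≪≫ e.unit.symm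

/-- Conjugation preserves composites, by the counit. -/
def conjComp (e : a' ≌ a) (e' : b' ≌ b) (e'' : c' ≌ c) (f : a ⟶ b) (g : b ⟶ c) :
    conj e e'' (f ≫ g) ≅ conj e e' f ≫ conj e' e'' g where
  hom := 𝟙 _ ⊗≫ (e.hom ≫ f) ◁ e'.counit.inv ▷ (g ≫ e''.inv) ⊗≫ 𝟙 _
  inv := 𝟙 _ ⊗≫ (e.hom ≫ f) ◁ e'.counit.hom ▷ (g ≫ e''.inv) ⊗≫ 𝟙 _
  hom_inv_id := by
    calc
      _ = 𝟙 _ ⊗≫ (e.hom ≫ f) ◁ (e'.counit.inv ≫ e'.counit.hom) ▷ (g ≫ e''.inv) ⊗≫ 𝟙 _ := by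
        bicategory
      _ = _ := by
        rw [Iso.inv_hom_id]; bicategory
  inv_hom_id := by
    calc
      _ = 𝟙 _ ⊗≫ (e.hom ≫ f) ◁ (e'.counit.hom ≫ e'.counit.inv) ▷ (g ≫ e''.inv) ⊗≫ 𝟙 _ := by
        bicategory
      _ = _ := by
        rw [Iso.hom_inv_id]; bicategory

theorem conj₂_whiskerLeft (e : a' ≌ a) (e' : b' ≌ b) (e'' : c' ≌ c) (f : a ⟶ b) {g h : b ⟶ c}
    (η : g ⟶ h) :
    conj₂ e e'' (f ◁ η) =
      (conjComp e e' e'' f g).hom ≫ conj e e' f ◁ conj₂ e' e'' η ≫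
        (conjComp e e' e'' f h).inv := by
  rw [← Category.assoc, Iso.eq_comp_inv]
  dsimp only [conjComp, conj, conj₂]
  calc
    _ = 𝟙 _ ⊗≫ e.hom ◁ f ◁ (𝟙 b ◁ η ≫ e'.counit.inv ▷ h) ▷ e''.inv ⊗≫ 𝟙 _ := by bicategory
    _ = _ := by rw [whisker_exchange]; bicategory

theorem conj₂_whiskerRight (e : a' ≌ a) (e' : b' ≌ b) (e'' : c' ≌ c) {f g : a ⟶ b}
    (η : f ⟶ g) (h : b ⟶ c) :
    conj₂ e e'' (η ▷ h) =
      (conjComp e e' e'' f h).hom ≫ conj₂ e e' η ▷ conj e' e'' h ≫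
        (conjComp e e' e'' g h).inv := by
  rw [← Category.assoc, Iso.eq_comp_inv]
  dsimp only [conjComp, conj, conj₂]
  calc
    _ = 𝟙 _ ⊗≫ e.hom ◁ (η ▷ 𝟙 b ≫ g ◁ e'.counit.inv) ▷ (h ≫ e''.inv) ⊗≫ 𝟙 _ := by bicategory
    _ = _ := by rw [← whisker_exchange]; bicategory

/-- The inverse counits of e' and e'' are inserted at different places, so interchange makes the
order irrelevant. -/
theorem conj₂_associator (e : a' ≌ a) (e' : b' ≌ b) (e'' : c' ≌ c) (e₃ : d' ≌ d) (f : a ⟶ b)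
    (g : b ⟶ c) (h : c ⟶ d) :
    conj₂ e e₃ (α_ f g h).hom =
      (conjComp e e'' e₃ (f ≫ g) h).hom ≫ (conjComp e e' e'' f g).hom ▷ conj e'' e₃ h ≫
        (α_ _ _ _).hom ≫ conj e e' f ◁ (conjComp e' e'' e₃ g h).inv ≫
          (conjComp e e' e₃ f (g ≫ h)).inv := by
  simp only [← Category.assoc]
  rw [Iso.eq_comp_inv]
  rw [← whiskerLeftIso_inv, Iso.eq_comp_inv]
  dsimp only [conjComp, conj, conj₂, whiskerLeftIso]
  calc
    _ = 𝟙 _ ⊗≫ e.hom ◁ f ◁ (e'.counit.inv ▷ (g ≫ 𝟙 c) ≫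
          (e'.inv ≫ e'.hom) ◁ g ◁ e''.counit.inv) ▷ (h ≫ e₃.inv) ⊗≫ 𝟙 _ := by
      bicategory
    _ = _ := by rw [← whisker_exchange]; bicategory

/-- Inserting the counit and then cancelling by the unit is a zigzag on `e.hom`, trivial by a
triangle identity. The right-hand law uses the other triangle, on `e'.inv`. -/
theorem conj₂_leftUnitor (e : a' ≌ a) (e' : b' ≌ b) (f : a ⟶ b) :
    conj₂ e e' (λ_ f).hom =
      (conjComp e e e' (𝟙 a) f).hom ≫ (conjId e).hom ▷ conj e e' f ≫ (λ_ (conj e e' f)).hom := by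
  symm
  dsimp only [conjComp, conjId, conj, conj₂, Iso.trans_hom, whiskerLeftIso, Iso.symm_hom]
  calc
    _ = 𝟙 _ ⊗≫ rightZigzag e.counit.inv e.unit.inv ▷ (f ≫ e'.inv) ⊗≫ 𝟙 _ := by
      dsimp only [rightZigzag]; bicategory
    _ = _ := by rw [← leftZigzagIso_inv, e.left_triangle, Iso.trans_inv, Iso.symm_inv]; bicategory

theorem conj₂_rightUnitor (e : a' ≌ a) (e' : b' ≌ b) (f : a ⟶ b) :
    conj₂ e e' (ρ_ f).hom =
      (conjComp e e' e' f (𝟙 b)).hom ≫ conj e e' f ◁ (conjId e').hom ≫ (ρ_ (conj e e' f)).hom := by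
  symm
  dsimp only [conjComp, conjId, conj, conj₂, Iso.trans_hom, whiskerLeftIso, Iso.symm_hom]
  calc
    _ = 𝟙 _ ⊗≫ (e.hom ≫ f) ◁ leftZigzag e'.counit.inv e'.unit.inv ⊗≫ 𝟙 _ := by
      dsimp only [leftZigzag]; bicategory
    _ = _ := by
      rw [← rightZigzagIso_inv, e'.right_triangle, Iso.trans_inv, Iso.symm_inv]; bicategory

/-- The comparison between conjugation and composition with the equivalences. -/
def conjNaturality (e : a' ≌ a) (e' : b' ≌ b) (f : a ⟶ b) : conj e e' f ≫ e'.hom ≅ e.hom ≫ f where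
  hom := 𝟙 _ ⊗≫ (e.hom ≫ f) ◁ e'.counit.hom ⊗≫ 𝟙 _
  inv := 𝟙 _ ⊗≫ (e.hom ≫ f) ◁ e'.counit.inv ⊗≫ 𝟙 _
  hom_inv_id := by
    calc
      _ = 𝟙 _ ⊗≫ (e.hom ≫ f) ◁ (e'.counit.hom ≫ e'.counit.inv) ⊗≫ 𝟙 _ := by bicategory
      _ = _ := by rw [Iso.hom_inv_id]; bicategory
  inv_hom_id := by
    calc
      _ = 𝟙 _ ⊗≫ (e.hom ≫ f) ◁ (e'.counit.inv ≫ e'.counit.hom) ⊗≫ 𝟙 _ := by bicategory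
      _ = _ := by rw [Iso.inv_hom_id]; bicategory

theorem conjNaturality_naturality (e : a' ≌ a) (e' : b' ≌ b) {f g : a ⟶ b} (η : f ⟶ g) :
    conj₂ e e' η ▷ e'.hom ≫ (conjNaturality e e' g).hom =
      (conjNaturality e e' f).hom ≫ e.hom ◁ η := by
  dsimp only [conjNaturality]
  calc
    _ = 𝟙 _ ⊗≫ e.hom ◁ (η ▷ (e'.inv ≫ e'.hom) ≫ g ◁ e'.counit.hom) ⊗≫ 𝟙 _ := by bicategory
    _ = _ := by rw [← whisker_exchange]; bicategory

theorem conjNaturality_id (e : a' ≌ a) :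
    (conjNaturality e e (𝟙 a)).hom =
      (conjId e).hom ▷ e.hom ≫ (λ_ e.hom).hom ≫ (ρ_ e.hom).inv := by
  symm
  dsimp only [conjNaturality, conjId, Iso.trans_hom, whiskerLeftIso, Iso.symm_hom]
  calc
    _ = 𝟙 _ ⊗≫ e.unit.inv ▷ e.hom ⊗≫ ((λ_ e.hom).hom ≫ (ρ_ e.hom).inv) ⊗≫ 𝟙 _ := by bicategory
    _ = 𝟙 _ ⊗≫ (e.unit.inv ≫ e.unit.hom) ▷ e.hom ⊗≫ e.hom ◁ e.counit.hom ⊗≫ 𝟙 _ := by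
      -- The unitors are expanded into a zigzag so that its unit cancels the inverse unit, leaving
      -- the counit alone.
      rw [← e.left_triangle_hom, leftZigzag]; bicategory
    _ = _ := by rw [Iso.inv_hom_id]; bicategory

theorem conjNaturality_comp (e : a' ≌ a) (e' : b' ≌ b) (e'' : c' ≌ c) (f : a ⟶ b) (g : b ⟶ c) :
    (conjNaturality e e'' (f ≫ g)).hom =
      (conjComp e e' e'' f g).hom ▷ e''.hom ≫ (α_ _ _ _).hom ≫
        conj e e' f ◁ (conjNaturality e' e'' g).hom ≫ (α_ _ _ _).inv ≫
          (conjNaturality e e' f).hom ▷ g ≫ (α_ _ _ _).hom := by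
  symm
  dsimp only [conjNaturality, conjComp, conj]
  calc
    _ = 𝟙 _ ⊗≫ (e.hom ≫ f) ◁ (e'.counit.inv ▷ (g ≫ e''.inv ≫ e''.hom) ≫
          (e'.inv ≫ e'.hom) ◁ g ◁ e''.counit.hom) ⊗≫
            (e.hom ≫ f) ◁ e'.counit.hom ▷ g ⊗≫ 𝟙 _ := by bicategory
    -- Interchange moves the counit of e'' first, bringing the inverse counit of e' next to the
    -- counit that cancels it.
    _ = 𝟙 _ ⊗≫ (e.hom ≫ f ≫ g) ◁ e''.counit.hom ⊗≫
            (e.hom ≫ f) ◁ (e'.counit.inv ≫ e'.counit.hom) ▷ g ⊗≫ 𝟙 _ := by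
      rw [← whisker_exchange]; bicategory
    _ = _ := by rw [Iso.inv_hom_id]; bicategory

end Conjugation

/-! ### The homomorphism to a full sub-bicategory and its pseudonatural equivalences. -/

section Reflection

variable {C : Type u} [Bicategory.{w, v} C] {X : Type u₁} {F : X → C} {s : C → X}

/-- If every object of `C` is equivalent to one in the image of `F : X → C`, conjugation by the
equivalences is a homomorphism to the bicategory induced by `F`. -/
def conjPseudofunctor (e : ∀ a : C, F (s a) ≌ a) : C ⥤ᵖ InducedBicategory C F where
  obj a := s a
  map {a b} f := InducedBicategory.mkHom (conj (e a) (e b) f)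
  map₂ {a b _ _} η := InducedBicategory.mkHom₂ (conj₂ (e a) (e b) η)
  map₂_id f := InducedBicategory.hom₂_ext (conj₂_id _ _ f)
  map₂_comp η θ := InducedBicategory.hom₂_ext (conj₂_comp _ _ η θ)
  mapId a := InducedBicategory.isoMk (conjId (e a))
  mapComp {a b c} f g := InducedBicategory.isoMk (conjComp (e a) (e b) (e c) f g)
  map₂_whisker_left f _ _ η := InducedBicategory.hom₂_ext (conj₂_whiskerLeft _ _ _ f η)
  map₂_whisker_right η h := InducedBicategory.hom₂_ext (conj₂_whiskerRight _ _ _ η h)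
  map₂_associator f g h := InducedBicategory.hom₂_ext (conj₂_associator _ _ _ _ f g h)
  map₂_left_unitor f := InducedBicategory.hom₂_ext (conj₂_leftUnitor _ _ f)
  map₂_right_unitor f := InducedBicategory.hom₂_ext (conj₂_rightUnitor _ _ f)

/-- The inclusion of the bicategory induced by `F : X → C`. -/
abbrev inducedInclusion (F : X → C) : InducedBicategory C F ⥤ᵖ C :=
  (InducedBicategory.forget (C := C) (F := F)).toPseudofunctor

/-- The equivalences themselves are the components of a transformation to the identity. -/
def conjCounit (e : ∀ a : C, F (s a) ≌ a) :
    Pseudofunctor.StrongTrans ((conjPseudofunctor e).comp (inducedInclusion F))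
      (Pseudofunctor.id C) where
  app a := (e a).hom
  naturality {a b} f := conjNaturality (e a) (e b) f
  naturality_naturality η := conjNaturality_naturality _ _ η
  naturality_id a := by
    change (conjNaturality (e a) (e a) (𝟙 a)).hom ≫ (e a).hom ◁ 𝟙 (𝟙 a) =
      ((conjId (e a)).hom ≫ 𝟙 (𝟙 _)) ▷ (e a).hom ≫ (λ_ (e a).hom).hom ≫ (ρ_ (e a).hom).inv
    rw [Category.comp_id, Bicategory.whiskerLeft_id, Category.comp_id, conjNaturality_id]
  naturality_comp {a b c} f g := by
    change (conjNaturality (e a) (e c) (f ≫ g)).hom ≫ (e a).hom ◁ 𝟙 (f ≫ g) =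
      ((conjComp (e a) (e b) (e c) f g).hom ≫ 𝟙 _) ▷ (e c).hom ≫ (α_ _ _ _).hom ≫
        conj (e a) (e b) f ◁ (conjNaturality (e b) (e c) g).hom ≫ (α_ _ _ _).inv ≫
          (conjNaturality (e a) (e b) f).hom ▷ g ≫ (α_ _ _ _).hom
    rw [Category.comp_id, Bicategory.whiskerLeft_id, Category.comp_id, conjNaturality_comp]

/-- The same equivalences are the components of a transformation to the identity of the induced
bicategory. -/
def conjUnit (e : ∀ a : C, F (s a) ≌ a) :
    Pseudofunctor.StrongTrans ((inducedInclusion F).comp (conjPseudofunctor e))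
      (Pseudofunctor.id (InducedBicategory C F)) where
  app x := InducedBicategory.mkHom (e (F x)).hom
  naturality {x y} f := InducedBicategory.isoMk (conjNaturality (e (F x)) (e (F y)) f.hom)
  naturality_naturality η :=
    InducedBicategory.hom₂_ext (conjNaturality_naturality (e _) (e _) η.hom)
  naturality_id x := InducedBicategory.hom₂_ext <| by
    -- The inclusion is applied first here, so its trivial constraint appears conjugated.
    change (conjNaturality (e (F x)) (e (F x)) (𝟙 (F x))).hom ≫ (e (F x)).hom ◁ 𝟙 (𝟙 (F x)) =
      (conj₂ (e (F x)) (e (F x)) (𝟙 (𝟙 (F x))) ≫ (conjId (e (F x))).hom) ▷ (e (F x)).hom ≫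
        (λ_ (e (F x)).hom).hom ≫ (ρ_ (e (F x)).hom).inv
    rw [conj₂_id, Category.id_comp, Bicategory.whiskerLeft_id, Category.comp_id,
      conjNaturality_id]
  naturality_comp {x y z} f g := InducedBicategory.hom₂_ext <| by
    change (conjNaturality (e (F x)) (e (F z)) (f.hom ≫ g.hom)).hom ≫
        (e (F x)).hom ◁ 𝟙 (f.hom ≫ g.hom) =
      (conj₂ (e (F x)) (e (F z)) (𝟙 (f.hom ≫ g.hom)) ≫
          (conjComp (e (F x)) (e (F y)) (e (F z)) f.hom g.hom).hom) ▷ (e (F z)).hom ≫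
        (α_ _ _ _).hom ≫
          conj (e (F x)) (e (F y)) f.hom ◁ (conjNaturality (e (F y)) (e (F z)) g.hom).hom ≫
            (α_ _ _ _).inv ≫ (conjNaturality (e (F x)) (e (F y)) f.hom).hom ▷ g.hom ≫
              (α_ _ _ _).hom
    rw [conj₂_id, Category.id_comp, Bicategory.whiskerLeft_id, Category.comp_id,
      conjNaturality_comp]

theorem isEquivalenceCell_hom {a b : C} (e : a ≌ b) : IsEquivalenceCell e.hom :=
  ⟨e.inv, ⟨e.unit.symm⟩, ⟨e.counit⟩⟩

theorem isEquivalenceCell_inv {a b : C} (e : a ≌ b) : IsEquivalenceCell e.inv :=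
  ⟨e.hom, ⟨e.counit⟩, ⟨e.unit.symm⟩⟩

theorem conjCounit_isPseudonaturalEquivalence (e : ∀ a : C, F (s a) ≌ a) :
    IsPseudonaturalEquivalence (conjCounit e) := fun a => isEquivalenceCell_hom (e a)

/-- Fullness puts the inverse, unit and counit of each chosen equivalence inside the induced
bicategory. -/
theorem conjUnit_isPseudonaturalEquivalence (e : ∀ a : C, F (s a) ≌ a) :
    IsPseudonaturalEquivalence (conjUnit e) := fun x =>
  ⟨InducedBicategory.mkHom (e (F x)).inv, ⟨InducedBicategory.isoMk (e (F x)).unit.symm⟩,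
    ⟨InducedBicategory.isoMk (e (F x)).counit⟩⟩

theorem inducedInclusion_isBiequivalence (e : ∀ a : C, F (s a) ≌ a) :
    IsBiequivalence (inducedInclusion F) where
  hom_equivalence _ _ :=
    { faithful := ⟨fun h => InducedBicategory.hom₂_ext h⟩
      full := ⟨fun η => ⟨⟨η⟩, rfl⟩⟩
      essSurj := ⟨fun f => ⟨InducedBicategory.mkHom f, ⟨Iso.refl _⟩⟩⟩ }
  surjective_up_to_equivalence a := ⟨s a, (e a).hom, isEquivalenceCell_hom (e a)⟩

end Reflection

end IconBicat

theorem mainTheorem3 :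
    -- every bicategory is equivalent, in the 2-category of bicategories, to a 2-category
    (∀ A : IconBicat.BicatTwo.{w, max u v, u}, ∃ S : IconBicat.BicatTwo.{w, max u v, u},
      Bicategory.Strict S.carrier ∧ ∃ F : A ⟶ S, IconBicat.IsEquivalenceCell F) ∧
    -- the inclusion of the full sub-2-category of 2-categories is a biequivalence
    IconBicat.IsBiequivalence IconBicat.strictInclusion.{w, max u v, u} ∧
    -- and it has an inverse homomorphism, up to pseudonatural equivalence
    ∃ (G : IconBicat.BicatTwo.{w, max u v, u} ⥤ᵖ IconBicat.StrictBicatTwo.{w, max u v, u})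
      (θ : Pseudofunctor.StrongTrans
        (G.comp IconBicat.strictInclusion) (Pseudofunctor.id IconBicat.BicatTwo.{w, max u v, u}))
      (ζ : Pseudofunctor.StrongTrans
        (IconBicat.strictInclusion.comp G)
        (Pseudofunctor.id IconBicat.StrictBicatTwo.{w, max u v, u})),
      IconBicat.IsPseudonaturalEquivalence θ ∧ IconBicat.IsPseudonaturalEquivalence ζ := by
  let s (A : IconBicat.BicatTwo.{w, max u v, u}) :
      {A : IconBicat.BicatTwo.{w, max u v, u} // Strict A.carrier} :=
    ⟨A.strictify, A.strictify_strict⟩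
  let e (A : IconBicat.BicatTwo.{w, max u v, u}) : (s A).1 ≌ A := A.strictifyEquivalence
  -- The chosen equivalences point from the strictification to A, so the first claim takes the
  -- inverse, the inclusion of paths of length one.
  exact ⟨fun A => ⟨A.strictify, A.strictify_strict, (e A).inv, IconBicat.isEquivalenceCell_inv _⟩,
    IconBicat.inducedInclusion_isBiequivalence e, IconBicat.conjPseudofunctor e,
    IconBicat.conjCounit e, IconBicat.conjUnit e,
    IconBicat.conjCounit_isPseudonaturalEquivalence e,
    IconBicat.conjUnit_isPseudonaturalEquivalence e⟩
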